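/- Mirror game: Alice and Bob alternately declare numbers from $\{1,\dots,2n\}$, Alice first, for $2n$ turns; the first player to declare a number that was already declared (by either player) loses, and if there is no repetition the game is a draw. An open-book Alice with $m$ bits of memory is given by an integer $\ell\ge 0$, an initial memory state in $\{0,1\}^m$, and two functions. In each of her turns she receives a fresh uniformly random string in $\{0,1\}^\ell$, which she keeps for the rest of the game at no memory cost. From her second turn on, a state transition function then computes her new memory state from Bob's last move, her previous memory state, the turn number and all random strings received so far. A next move function computes the number she declares from her current memory state, the turn number and all random strings received so far. Bob knows these functions. When he moves, he sees all previous moves, Alice's past and current memory states, and all random strings she has received so far, but not her future ones. His strategy may be randomized and is not restricted in memory or computation. Let $c\ge 2$ be a real number. To every $n$, $m$ and every open-book Alice with $m$ bits of memory in the game on $\{1,\dots,2n\}$ one can assign a strategy of Bob (not depending on $\varepsilon$) such that the following holds. For every $\varepsilon>0$ there is an $N$, depending only on $c$ and $\varepsilon$, such that for all $n\ge N$, every open-book Alice with $m\le \frac{n}{4c}$ bits of memory loses against the strategy assigned to her with probability at least $$1-\left(\tfrac12+\varepsilon\right)^{c/2},$$ where the probability is over the coins of both players. -/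

import Mathlib

namespace MirrorGame

/-- Bit strings of length `k`. -/
abbrev Bits (k : ℕ) : Type := Fin k → Bool

/-- A strategy of Alice in the mirror game on `2 * n` numbers, with `m` bits of memory and `ℓ` fresh
random bits per round.  The list argument of `upd` and `nxt` holds all the random strings that Alice
has drawn so far, in chronological order, the one of the current round included; its length is the
number of the current round, so both functions also know the turn number. -/
structure AliceStrategy (n m ℓ : ℕ) where
  /-- the initial memory state -/
  start : Bits m
  /-- state transition: last move of Bob, old memory state, random strings so far -/
  upd : Fin (2 * n) → Bits m → List (Bits ℓ) → Bits m
  /-- next move: current memory state, random strings so far -/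
  nxt : Bits m → List (Bits ℓ) → Fin (2 * n)

/-- What happens in one round: the random string drawn by Alice, her memory state when she moves,
her number, and Bob's number. -/
structure Round (n m ℓ : ℕ) where
  coins : Bits ℓ
  mem : Bits m
  alice : Fin (2 * n)
  bob : Fin (2 * n)

/-- A (randomized, computationally unbounded) strategy of Bob against an open-book Alice.  When he
moves, Bob sees all the previous rounds, Alice's memory states and random strings included, and the
random string, memory state and move of Alice in the current round.  He does not see the random
strings of later rounds.  He answers with a probability distribution on the numbers. -/
abbrev BobStrategy (n m ℓ : ℕ) : Type :=
  List (Round n m ℓ) → Bits ℓ → Bits m → Fin (2 * n) → PMF (Fin (2 * n))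

variable {n m ℓ : ℕ}

/-- The random strings that Alice has access to in the round after the history `h` (chronological),
when she draws `r` in it. -/
def coinsSoFar (h : List (Round n m ℓ)) (r : Bits ℓ) : List (Bits ℓ) :=
  h.map Round.coins ++ [r]

/-- Alice's memory state in the round after the history `h`, when she draws `r` in it: the initial
state in the first round, and afterwards the update of the previous state by Bob's last move. -/
def memory (A : AliceStrategy n m ℓ) (h : List (Round n m ℓ)) (r : Bits ℓ) : Bits m :=
  match h.getLast? with
  | none => A.start
  | some q => A.upd q.bob q.mem (coinsSoFar h r)

/-- Alice's number in the round after the history `h`, when she draws `r` in it. -/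
def aliceMove (A : AliceStrategy n m ℓ) (h : List (Round n m ℓ)) (r : Bits ℓ) : Fin (2 * n) :=
  A.nxt (memory A h r) (coinsSoFar h r)

/-- One more round after the history `h`: Alice draws `ℓ` uniform bits, independent of the past, and
moves; then Bob moves. -/
noncomputable def playRound (A : AliceStrategy n m ℓ) (B : BobStrategy n m ℓ)
    (h : List (Round n m ℓ)) : PMF (List (Round n m ℓ)) :=
  (PMF.uniformOfFintype (Bits ℓ)).bind fun r =>
    (B h r (memory A h r) (aliceMove A h r)).map fun b =>
      h ++ [⟨r, memory A h r, aliceMove A h r, b⟩]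

/-- The law of the first `k` rounds. -/
noncomputable def play (A : AliceStrategy n m ℓ) (B : BobStrategy n m ℓ) :
    ℕ → PMF (List (Round n m ℓ))
  | 0 => PMF.pure []
  | k + 1 => (play A B k).bind (playRound A B)

/-- The numbers declared in a history, in the order of the turns (Alice, Bob, Alice, Bob, …). -/
def moves (h : List (Round n m ℓ)) : List (Fin (2 * n)) :=
  h.flatMap fun q => [q.alice, q.bob]

/-- The first repetition of a number is by Alice: for some `i` there is none in the first `2 * i`
turns, and there is one in turn `2 * i + 1`.  The game is decided at the first repetition; what is
played after it has no influence. -/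
def AliceLoses (w : List (Fin (2 * n))) : Prop :=
  ∃ i : ℕ, (w.take (2 * i)).Nodup ∧ ¬ (w.take (2 * i + 1)).Nodup

/-- The probability, over the coins of both players, that Alice loses the game of `2 * n` turns. -/
noncomputable def lossProb (A : AliceStrategy n m ℓ) (B : BobStrategy n m ℓ) : ℝ :=
  ((play A B n).toOuterMeasure {h | AliceLoses (moves h)}).toReal

end MirrorGame

namespace MirrorGame

open Finset
open scoped BigOperators ENNReal

/-! ### Families of used sets ("worlds") and parity -/

section Worlds

variable {α : Type*} [DecidableEq α]

/-! Given her coins, Alice's next move depends only on her state (Bob's last move and her memory),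
not otherwise on the set of used numbers. So positions with the same state but different used sets,
the "worlds", can be averaged: one answer of Bob that is unused in all of them bounds the average of
the optimal values, and leaves Alice in a common state.

Suppose `j` disjoint pairs of equally large sets are reserved, and the worlds are the `2 ^ j` ways
of having one side of each pair used. If Alice plays into a pair, she repeats a number in half of
the worlds; in the other half that pair is settled and the rest remain. The numbers outside the
pairs run out, so her average chance of survival is at most `2⁻ʲ` (`worldAvg_drawValue_le_pow`).

A new pair comes from an epoch of `T` rounds in which Bob plays random free numbers. Fix the coins
and the state at its end, and call a used set bad if its value exceeds the target. Two bad sets `D`,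
`E` with `#(D \ E)` even would give a new pair `D \ E`, `E \ D`, and the induction hypothesis for
one more pair bounds their average by the target, a contradiction. So the bad sets have pairwise odd
differences, and linear algebra mod 2 leaves at most `2n + 1` of them per state
(`card_le_of_odd_sdiff`), hence at most `(2n * 2 ^ m + 1) * (2n + 1)` in all. While Alice avoids the
pairs, random play reaches each with chance at most `2⁻ᵀ` (`worldAvg_drawValue_le_coinAvg`). Thus
each epoch gains a factor `1/2` up to a small error (`worldAvg_drawValue_le`).

With `⌈c/2⌉` epochs there is room for `T = ⌊n / (3⌈c/2⌉)⌋`, which exceeds `m` by a linear amount, so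
the error tends to `0`. Backward induction turns the bound on the value into one strategy,
`optimalBob`. -/

/-- A family of sets of equal size with pairwise odd differences has at most `|α| + 1` members. -/
lemma card_le_of_odd_sdiff [Fintype α] (F : Finset (Finset α)) (s : ℕ) (hs : ∀ A ∈ F, #A = s)
    (hF : ∀ A ∈ F, ∀ B ∈ F, A ≠ B → Odd #(A \ B)) : #F ≤ Fintype.card α + 1 := by
  classical
  -- Incidence vectors mod 2. The extra coordinate `s + 1` adds `s + 1` to each inner product `#(A ∩
  -- B)`, which makes the rows orthonormal, so their number is at most the number of columns.
  let M : Matrix F (Option α) (ZMod 2) := fun A x =>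
    x.elim ((s : ZMod 2) + 1) fun y => if y ∈ A.1 then 1 else 0
  have hM : M * M.transpose = 1 := by
    ext A B
    have hsum : ∑ y : α, ((if y ∈ A.1 then 1 else 0) * (if y ∈ B.1 then 1 else 0) : ZMod 2)
        = (#(A.1 ∩ B.1) : ZMod 2) := by
      simp [← ite_and, ← Finset.mem_inter, Finset.inter_comm]
    have hcard : (#(A.1 ∩ B.1) : ZMod 2) + (#(A.1 \ B.1) : ZMod 2) = s := by
      rw [← Nat.cast_add, Finset.card_inter_add_card_sdiff, hs A.1 A.2]
    have h2 : ∀ x : ZMod 2, x + x = 0 := fun x => CharTwo.add_self_eq_zero x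
    have hsq : ((s : ZMod 2) + 1) * ((s : ZMod 2) + 1) = s + 1 := by
      generalize (s : ZMod 2) = x
      revert x
      decide
    have hentry : (M * M.transpose) A B = (s + 1) * (s + 1) + #(A.1 ∩ B.1) := by
      rw [Matrix.mul_apply, Fintype.sum_option, ← hsum]
      rfl
    rw [hentry, hsq]
    by_cases hAB : A = B
    · subst hAB
      rw [Finset.sdiff_self] at hcard
      simp only [Finset.card_empty, Nat.cast_zero, add_zero] at hcard
      rw [hcard, Matrix.one_apply_eq]
      linear_combination h2 s
    · rw [Matrix.one_apply_ne hAB]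
      have hodd := hF A.1 A.2 B.1 B.2 (fun h => hAB (Subtype.ext h))
      rw [← ZMod.natCast_eq_one_iff_odd] at hodd
      rw [hodd] at hcard
      rw [← hcard]
      linear_combination h2 (#(A.1 ∩ B.1) : ZMod 2) + h2 1
  have h1 : (M * M.transpose).rank ≤ M.rank := Matrix.rank_mul_le_left _ _
  rw [hM, Matrix.rank_one] at h1
  have h3 := M.rank_le_card_width
  rw [Fintype.card_option] at h3
  simpa using h1.trans h3

/-- The average of `ψ` over all sets that arise from `C` by adding one side of each of the pairs
in the list. -/
noncomputable def worldAvg : List (Finset α × Finset α) → (Finset α → ℝ) → Finset α → ℝ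
  | [], ψ, C => ψ C
  | p :: G, ψ, C => (worldAvg G ψ (C ∪ p.1) + worldAvg G ψ (C ∪ p.2)) / 2

lemma worldAvg_perm {G G' : List (Finset α × Finset α)} (h : G.Perm G') (ψ : Finset α → ℝ)
    (C : Finset α) : worldAvg G ψ C = worldAvg G' ψ C := by
  induction h generalizing C with
  | nil => rfl
  | cons p _ ih => simp only [worldAvg, ih]
  | swap p q G =>
    simp only [worldAvg]
    rw [Finset.union_right_comm C q.1 p.1, Finset.union_right_comm C q.1 p.2,
      Finset.union_right_comm C q.2 p.1, Finset.union_right_comm C q.2 p.2]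
    ring
  | trans _ _ ih₁ ih₂ => rw [ih₁, ih₂]

lemma worldAvg_mono (G : List (Finset α × Finset α)) {ψ φ : Finset α → ℝ} {C : Finset α}
    (h : ∀ D, C ⊆ D → (∀ x ∈ D, x ∈ C ∨ ∃ p ∈ G, x ∈ p.1 ∪ p.2) → ψ D ≤ φ D) :
    worldAvg G ψ C ≤ worldAvg G φ C := by
  induction G generalizing C with
  | nil => exact h C subset_rfl fun x hx => Or.inl hx
  | cons p G ih =>
    have h1 : ∀ Z, Z ⊆ p.1 ∪ p.2 → worldAvg G ψ (C ∪ Z) ≤ worldAvg G φ (C ∪ Z) := by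
      intro Z hZ
      refine ih fun D hCD hD => h D (Finset.subset_union_left.trans hCD) fun x hx => ?_
      rcases hD x hx with hx | ⟨q, hq, hx⟩
      · rcases Finset.mem_union.1 hx with hx | hx
        · exact Or.inl hx
        · exact Or.inr ⟨p, List.mem_cons_self, hZ hx⟩
      · exact Or.inr ⟨q, List.mem_cons_of_mem _ hq, hx⟩
    have h2 := h1 p.1 Finset.subset_union_left
    have h3 := h1 p.2 Finset.subset_union_right
    simp only [worldAvg]
    linarith

lemma worldAvg_const (G : List (Finset α × Finset α)) (x : ℝ) (C : Finset α) :
    worldAvg G (fun _ => x) C = x := by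
  induction G generalizing C with
  | nil => rfl
  | cons p G ih => simp [worldAvg, ih]

lemma worldAvg_expect {ι : Type*} (s : Finset ι) (G : List (Finset α × Finset α))
    (ψ : ι → Finset α → ℝ) (C : Finset α) :
    worldAvg G (fun D => 𝔼 i ∈ s, ψ i D) C = 𝔼 i ∈ s, worldAvg G (ψ i) C := by
  induction G generalizing C with
  | nil => rfl
  | cons p G ih => simp only [worldAvg, ih, ← Finset.expect_add_distrib, Finset.expect_div]

lemma worldAvg_insert (G : List (Finset α × Finset α)) (ψ : Finset α → ℝ) (C : Finset α) (a : α) :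
    worldAvg G (fun D => ψ (insert a D)) C = worldAvg G ψ (insert a C) := by
  induction G generalizing C with
  | nil => rfl
  | cons p G ih => simp only [worldAvg, ih, Finset.insert_union]

/-- The pairs in `G` consist of disjoint nonempty sets of the same even size, and different pairs
are disjoint from each other and from `C`. -/
structure Good (G : List (Finset α × Finset α)) (C : Finset α) : Prop where
  pair : ∀ p ∈ G, Disjoint p.1 p.2 ∧ #p.1 = #p.2 ∧ Even #p.1 ∧ p.1.Nonempty
  disj : G.Pairwise fun p q => Disjoint (p.1 ∪ p.2) (q.1 ∪ q.2)
  base : ∀ p ∈ G, Disjoint C (p.1 ∪ p.2)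

/-- The total size of the unused sides of the pairs. -/
def reserve (G : List (Finset α × Finset α)) : ℕ := (G.map fun p => #p.1).sum

lemma Good.perm {G G' : List (Finset α × Finset α)} {C : Finset α} (h : Good G C)
    (hG : G.Perm G') : Good G' C :=
  ⟨fun p hp => h.pair p (hG.mem_iff.2 hp), (hG.pairwise_iff fun h => h.symm).1 h.disj,
    fun p hp => h.base p (hG.mem_iff.2 hp)⟩

/-- This is why pairs have even sides: in every world the number of unused elements is even when
Alice moves, so the free set is even too, and Bob has a free answer to each free move. -/
lemma Good.even_reserve {G : List (Finset α × Finset α)} {C : Finset α} (h : Good G C) :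
    Even (reserve G) := by
  obtain ⟨h, -, -⟩ := h
  induction G with
  | nil => exact ⟨0, rfl⟩
  | cons p G ih =>
    have := ih fun q hq => h q (List.mem_cons_of_mem _ hq)
    simp only [reserve, List.map_cons, List.sum_cons] at this ⊢
    exact (h p List.mem_cons_self).2.2.1.add this

lemma insert_insert_eq_union (a b : α) (C : Finset α) :
    insert b (insert a C) = C ∪ {a, b} := by
  ext x
  simp only [Finset.mem_insert, Finset.mem_union, Finset.mem_singleton]
  tauto

lemma Good.swap {X Y : Finset α} {G : List (Finset α × Finset α)} {C : Finset α}
    (h : Good ((X, Y) :: G) C) : Good ((Y, X) :: G) C := by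
  have h1 := h.pair (X, Y) List.mem_cons_self
  have h3 := h.base (X, Y) List.mem_cons_self
  have h2 := List.pairwise_cons.1 h.disj
  refine ⟨?_, ?_, ?_⟩
  · refine List.forall_mem_cons.2 ⟨⟨h1.1.symm, h1.2.1.symm, ?_, ?_⟩,
      fun q hq => h.pair q (List.mem_cons_of_mem _ hq)⟩
    · exact h1.2.1 ▸ h1.2.2.1
    · have := Finset.card_pos.2 h1.2.2.2
      rw [h1.2.1] at this
      exact Finset.card_pos.1 this
  · refine List.pairwise_cons.2 ⟨fun q hq => ?_, h2.2⟩
    have := h2.1 q hq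
    rwa [Finset.union_comm] at this
  · refine List.forall_mem_cons.2 ⟨?_, fun q hq => h.base q (List.mem_cons_of_mem _ hq)⟩
    rwa [Finset.union_comm] at h3

/-- Two used sets of the same size with an even difference form a new pair. -/
lemma Good.cons_of_even_sdiff {G : List (Finset α × Finset α)} {C D : Finset α} (hC : Good G C)
    (hD : Good G D) (hcard : #C = #D) (hne : C ≠ D) (heven : Even #(C \ D)) :
    Good ((C \ D, D \ C) :: G) (C ∩ D) := by
  have hcomm : #(C \ D) = #(D \ C) := by
    have h1 := Finset.card_inter_add_card_sdiff C D
    have h2 := Finset.card_inter_add_card_sdiff D C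
    rw [Finset.inter_comm] at h2
    omega
  refine ⟨List.forall_mem_cons.2 ⟨⟨?_, hcomm, heven, ?_⟩, hC.pair⟩,
    List.pairwise_cons.2 ⟨fun q hq => ?_, hC.disj⟩, List.forall_mem_cons.2 ⟨?_, fun q hq => ?_⟩⟩
  · exact disjoint_sdiff_sdiff
  · refine Finset.sdiff_nonempty.2 fun hsub => hne ?_
    exact Finset.eq_of_subset_of_card_le hsub hcard.ge
  · exact Finset.disjoint_union_left.2 ⟨(hC.base q hq).mono_left Finset.sdiff_subset,
      (hD.base q hq).mono_left Finset.sdiff_subset⟩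
  · rw [Finset.disjoint_left]
    intro x
    simp only [Finset.mem_inter, Finset.mem_union, Finset.mem_sdiff]
    tauto
  · exact (hC.base q hq).mono_left Finset.inter_subset_left

variable [Fintype α]

/-- The elements that are neither in `C` nor in one of the pairs. -/
def freeSet (G : List (Finset α × Finset α)) (C : Finset α) : Finset α :=
  univ.filter fun x => x ∉ C ∧ ∀ p ∈ G, x ∉ p.1 ∪ p.2

lemma mem_freeSet {G : List (Finset α × Finset α)} {C : Finset α} {x : α} :
    x ∈ freeSet G C ↔ x ∉ C ∧ ∀ p ∈ G, x ∉ p.1 ∪ p.2 := by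
  simp [freeSet]

lemma freeSet_perm {G G' : List (Finset α × Finset α)} (hG : G.Perm G') (C : Finset α) :
    freeSet G C = freeSet G' C := by
  ext x
  simp [mem_freeSet, hG.mem_iff]

lemma Good.union {G : List (Finset α × Finset α)} {C Z : Finset α} (h : Good G C)
    (hZ : Z ⊆ freeSet G C) : Good G (C ∪ Z) := by
  refine ⟨h.pair, h.disj, fun p hp => Finset.disjoint_union_left.2 ⟨h.base p hp, ?_⟩⟩
  exact Finset.disjoint_left.2 fun x hx => (mem_freeSet.1 (hZ hx)).2 p hp

lemma freeSet_union (G : List (Finset α × Finset α)) (C Z : Finset α) :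
    freeSet G (C ∪ Z) = freeSet G C \ Z := by
  ext x
  simp only [mem_freeSet, Finset.mem_union, Finset.mem_sdiff]
  tauto

lemma card_freeSet_union (G : List (Finset α × Finset α)) {C Z : Finset α}
    (hZ : Z ⊆ freeSet G C) : #(freeSet G (C ∪ Z)) + #Z = #(freeSet G C) := by
  rw [freeSet_union, Finset.card_sdiff_add_card_eq_card hZ]

/-- The choice of one side of a pair: the pair is removed, and one side joins the used set. -/
lemma Good.resolve {p : Finset α × Finset α} {G : List (Finset α × Finset α)} {C : Finset α}
    (h : Good (p :: G) C) : Good G (C ∪ p.2) ∧ p.1 ⊆ freeSet G (C ∪ p.2) ∧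
      #(freeSet G (C ∪ p.2)) = #(freeSet (p :: G) C) + #p.1 := by
  obtain ⟨hp, -, -, -⟩ := h.pair p List.mem_cons_self
  have hb := Finset.disjoint_union_right.1 (h.base p List.mem_cons_self)
  have hd := (List.pairwise_cons.1 h.disj).1
  have hsub : p.1 ⊆ freeSet G (C ∪ p.2) := by
    intro x hx
    refine mem_freeSet.2 ⟨?_, fun q hq => ?_⟩
    · rw [Finset.mem_union, not_or]
      exact ⟨Finset.disjoint_right.1 hb.1 hx, Finset.disjoint_left.1 hp hx⟩
    · exact Finset.disjoint_left.1 (hd q hq) (Finset.mem_union_left _ hx)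
  refine ⟨⟨fun q hq => h.pair q (List.mem_cons_of_mem _ hq), (List.pairwise_cons.1 h.disj).2,
    fun q hq => Finset.disjoint_union_left.2 ⟨h.base q (List.mem_cons_of_mem _ hq), ?_⟩⟩, hsub, ?_⟩
  · exact (hd q hq).mono_left Finset.subset_union_right
  · have : freeSet (p :: G) C = freeSet G (C ∪ p.2) \ p.1 := by
      ext x
      simp only [mem_freeSet, Finset.mem_union, Finset.mem_sdiff, List.forall_mem_cons]
      tauto
    rw [this, Finset.card_sdiff_add_card_eq_card hsub]

lemma freeSet_swap (X Y : Finset α) (G : List (Finset α × Finset α)) (C : Finset α) :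
    freeSet ((Y, X) :: G) C = freeSet ((X, Y) :: G) C := by
  ext x
  simp only [mem_freeSet, List.forall_mem_cons, Finset.union_comm]

/-- A pair that contains a given element can be put first in the list, with the element in its
first component. -/
lemma Good.exists_front {G : List (Finset α × Finset α)} {C : Finset α} (h : Good G C) {a : α}
    {p : Finset α × Finset α} (hp : p ∈ G) (ha : a ∈ p.1 ∪ p.2) :
    ∃ (q : Finset α × Finset α) (G' : List (Finset α × Finset α)), a ∈ q.1 ∧ Good (q :: G') C ∧
      G.length = G'.length + 1 ∧ reserve G = #q.1 + reserve G' ∧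
      freeSet G C = freeSet (q :: G') C ∧
      ∀ ψ, worldAvg G ψ C = worldAvg (q :: G') ψ C := by
  have hG := List.perm_cons_erase hp
  have hlen := hG.length_eq
  have hres : reserve G = reserve (p :: G.erase p) := (hG.map _).sum_eq
  have hg := h.perm hG
  obtain ⟨X, Y⟩ := p
  rcases Finset.mem_union.1 ha with ha | ha
  · exact ⟨(X, Y), _, ha, hg, hlen, hres, freeSet_perm hG C, fun ψ => worldAvg_perm hG ψ C⟩
  · refine ⟨(Y, X), _, ha, hg.swap, hlen, ?_, ?_, fun ψ => ?_⟩
    · rw [hres, ← (hg.pair (X, Y) List.mem_cons_self).2.1]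
      rfl
    · rw [freeSet_perm hG C, freeSet_swap]
    · rw [worldAvg_perm hG ψ C]
      simp only [worldAvg]
      ring

lemma card_freeSet_cons_sdiff {G : List (Finset α × Finset α)} {C D : Finset α}
    (hD : Good G D) :
    #(freeSet ((C \ D, D \ C) :: G) (C ∩ D)) + #(D \ C) = #(freeSet G C) := by
  have hsub : D \ C ⊆ freeSet G C := by
    intro x hx
    have hx := Finset.mem_sdiff.1 hx
    exact mem_freeSet.2 ⟨hx.2, fun q hq => Finset.disjoint_left.1 (hD.base q hq) hx.1⟩
  have : freeSet ((C \ D, D \ C) :: G) (C ∩ D) = freeSet G C \ (D \ C) := by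
    ext x
    simp only [mem_freeSet, Finset.mem_union, Finset.mem_inter, Finset.mem_sdiff,
      List.forall_mem_cons]
    tauto
  rw [this, Finset.card_sdiff_add_card_eq_card hsub]

end Worlds

/-! ### The value of the game and the bound from reserved pairs -/

section DrawValue

variable {n m ℓ : ℕ}

/-- What Alice's memory depends on besides her random strings: Bob's last move and the previous
memory state, or nothing before the first round. -/
abbrev State (n m : ℕ) : Type := Option (Fin (2 * n) × Bits m)

/-- Alice's memory state in the state `σ`, when she has drawn the random strings `cs`. -/
def stateMem (A : AliceStrategy n m ℓ) (σ : State n m) (cs : List (Bits ℓ)) : Bits m :=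
  σ.elim A.start fun q => A.upd q.1 q.2 cs

/-- Alice's number in the state `σ`, when she has drawn the random strings `cs`. -/
def stateMove (A : AliceStrategy n m ℓ) (σ : State n m) (cs : List (Bits ℓ)) : Fin (2 * n) :=
  A.nxt (stateMem A σ cs) cs

/-- The value of Bob's move `b` against Alice's move `a` and memory `x`, if `ψ` is the value of the
next round. -/
noncomputable def bobValue (ψ : State n m → Finset (Fin (2 * n)) → ℝ) (x : Bits m)
    (C : Finset (Fin (2 * n))) (b : Fin (2 * n)) : ℝ :=
  if b ∈ C then 1 else ψ (some (b, x)) (insert b C)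

/-- The value of a round in which Alice has drawn the last string in `cs` already, if `C` is the
set of used numbers and `ψ` is the value of the next round. -/
noncomputable def roundValue (A : AliceStrategy n m ℓ) (ψ : State n m → Finset (Fin (2 * n)) → ℝ)
    (cs : List (Bits ℓ)) (σ : State n m) (C : Finset (Fin (2 * n))) : ℝ :=
  if stateMove A σ cs ∈ C then 0
  else ⨅ b, bobValue ψ (stateMem A σ cs) (insert (stateMove A σ cs) C) b

/-- The least probability, over Bob's strategies, that Alice does not lose within the next `k`
rounds, when she has drawn the strings `cs`, is in the state `σ`, and `C` is the set of used
numbers. -/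
noncomputable def drawValue (A : AliceStrategy n m ℓ) :
    ℕ → List (Bits ℓ) → State n m → Finset (Fin (2 * n)) → ℝ
  | 0, _, _, _ => 1
  | k + 1, cs, σ, C => 𝔼 r : Bits ℓ, roundValue A (drawValue A k (cs ++ [r])) (cs ++ [r]) σ C

variable (A : AliceStrategy n m ℓ)

lemma bobValue_mem_Icc {ψ : State n m → Finset (Fin (2 * n)) → ℝ}
    (hψ : ∀ σ C, ψ σ C ∈ Set.Icc (0 : ℝ) 1) (x : Bits m) (C : Finset (Fin (2 * n)))
    (b : Fin (2 * n)) : bobValue ψ x C b ∈ Set.Icc (0 : ℝ) 1 := by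
  unfold bobValue
  split_ifs
  · exact ⟨zero_le_one, le_rfl⟩
  · exact hψ _ _

lemma roundValue_le {ψ : State n m → Finset (Fin (2 * n)) → ℝ} {cs : List (Bits ℓ)}
    {σ : State n m} {C : Finset (Fin (2 * n))} (h : stateMove A σ cs ∉ C) (b : Fin (2 * n)) :
    roundValue A ψ cs σ C ≤ bobValue ψ (stateMem A σ cs) (insert (stateMove A σ cs) C) b := by
  rw [roundValue, if_neg h]
  exact ciInf_le (Set.finite_range _).bddBelow b

lemma roundValue_mem_Icc {ψ : State n m → Finset (Fin (2 * n)) → ℝ}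
    (hψ : ∀ σ C, ψ σ C ∈ Set.Icc (0 : ℝ) 1) (cs : List (Bits ℓ)) (σ : State n m)
    (C : Finset (Fin (2 * n))) : roundValue A ψ cs σ C ∈ Set.Icc (0 : ℝ) 1 := by
  by_cases h : stateMove A σ cs ∈ C
  · rw [roundValue, if_pos h]
    exact ⟨le_rfl, zero_le_one⟩
  · refine ⟨?_, (roundValue_le A h (stateMove A σ cs)).trans (bobValue_mem_Icc hψ _ _ _).2⟩
    rw [roundValue, if_neg h]
    exact Real.iInf_nonneg fun b => (bobValue_mem_Icc hψ _ _ _).1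

lemma drawValue_mem_Icc (k : ℕ) (cs : List (Bits ℓ)) (σ : State n m)
    (C : Finset (Fin (2 * n))) : drawValue A k cs σ C ∈ Set.Icc (0 : ℝ) 1 := by
  induction k generalizing cs σ C with
  | zero => exact ⟨zero_le_one, le_rfl⟩
  | succ k ih =>
    have h := fun r : Bits ℓ => roundValue_mem_Icc A (ih (cs ++ [r])) (cs ++ [r]) σ C
    exact ⟨Finset.expect_nonneg fun r _ => (h r).1,
      Finset.expect_le Finset.univ_nonempty fun r _ => (h r).2⟩

variable {A}

/-- The family of worlds in which Alice is in state `σ`: `ψ` averaged over it is bounded by what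
Bob gets from a move `b` that is unused in all of them. -/
lemma worldAvg_roundValue_le {ψ : State n m → Finset (Fin (2 * n)) → ℝ}
    (hψ : ∀ σ C, 0 ≤ ψ σ C) {cs : List (Bits ℓ)} {σ : State n m}
    {G : List (Finset (Fin (2 * n)) × Finset (Fin (2 * n)))} {C : Finset (Fin (2 * n))}
    {b : Fin (2 * n)} (hb : b ∈ freeSet G C) (hba : b ≠ stateMove A σ cs) :
    worldAvg G (roundValue A ψ cs σ) C ≤
      worldAvg G (ψ (some (b, stateMem A σ cs))) (C ∪ {stateMove A σ cs, b}) := by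
  have hb' := mem_freeSet.1 hb
  rw [← insert_insert_eq_union, ← worldAvg_insert, ← worldAvg_insert]
  -- In the worlds that already contain Alice's number her value is `0`, so adding it to the used
  -- set there only weakens the bound.
  refine worldAvg_mono G fun D hCD hD => ?_
  by_cases ha : stateMove A σ cs ∈ D
  · rw [roundValue, if_pos ha]
    exact hψ _ _
  · refine (roundValue_le A ha b).trans_eq ?_
    rw [bobValue, if_neg]
    rw [Finset.mem_insert, not_or]
    refine ⟨hba, fun hbD => ?_⟩
    rcases hD b hbD with h | ⟨p, hp, h⟩
    · exact hb'.1 h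
    · exact hb'.2 p hp h

lemma worldAvg_roundValue_of_mem {ψ : State n m → Finset (Fin (2 * n)) → ℝ} {cs : List (Bits ℓ)}
    {σ : State n m} (G : List (Finset (Fin (2 * n)) × Finset (Fin (2 * n))))
    {C : Finset (Fin (2 * n))} (ha : stateMove A σ cs ∈ C) :
    worldAvg G (roundValue A ψ cs σ) C ≤ 0 := by
  refine (worldAvg_mono G fun D hCD _ => ?_).trans_eq (worldAvg_const G 0 C)
  rw [roundValue, if_pos (hCD ha)]

/-- If Alice plays in a pair, she loses in half of the worlds, and the pair disappears. -/
lemma exists_resolve {ψ : State n m → Finset (Fin (2 * n)) → ℝ}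
    (hψ : ∀ σ C, 0 ≤ ψ σ C) {cs : List (Bits ℓ)} {σ : State n m}
    {G : List (Finset (Fin (2 * n)) × Finset (Fin (2 * n)))} {C : Finset (Fin (2 * n))}
    (hG : Good G C) {p : Finset (Fin (2 * n)) × Finset (Fin (2 * n))} (hp : p ∈ G)
    (ha : stateMove A σ cs ∈ p.1 ∪ p.2) :
    ∃ (G' : List (Finset (Fin (2 * n)) × Finset (Fin (2 * n)))) (C' : Finset (Fin (2 * n)))
      (σ' : State n m), Good G' C' ∧ G'.length + 1 = G.length ∧
      #(freeSet G' C') + reserve G' + 2 = #(freeSet G C) + reserve G ∧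
      #(freeSet G C) ≤ #(freeSet G' C') ∧
      worldAvg G (roundValue A ψ cs σ) C ≤ worldAvg G' (ψ σ') C' / 2 := by
  obtain ⟨q, G', haq, hq, hlen, hres, hfree, havg⟩ := hG.exists_front hp ha
  obtain ⟨hgood, hsub, hcard⟩ := hq.resolve
  obtain ⟨-, -, heven, hne⟩ := hq.pair q List.mem_cons_self
  have htwo : 2 ≤ #q.1 := by
    have := Finset.card_pos.2 hne
    obtain ⟨x, hx⟩ := heven
    omega
  -- In the surviving worlds `q.2` is used and `q.1` is entirely unused, so Bob answers inside
  -- `q.1`; even and nonempty means at least two elements.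
  obtain ⟨b, hbq, hba⟩ := Finset.exists_mem_ne (show 1 < #q.1 by omega) (stateMove A σ cs)
  have hpair : {stateMove A σ cs, b} ⊆ freeSet G' (C ∪ q.2) := by
    intro x hx
    rcases Finset.mem_insert.1 hx with rfl | hx
    · exact hsub haq
    · exact hsub (Finset.mem_singleton.1 hx ▸ hbq)
  have hcard2 := card_freeSet_union G' hpair
  rw [Finset.card_pair hba.symm] at hcard2
  refine ⟨G', C ∪ q.2 ∪ {stateMove A σ cs, b}, some (b, stateMem A σ cs), hgood.union hpair,
    hlen.symm, ?_, ?_, ?_⟩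
  · rw [hfree, hres]
    omega
  · rw [hfree]
    omega
  · rw [havg, worldAvg]
    have h1 := worldAvg_roundValue_of_mem (ψ := ψ) G' (Finset.mem_union_right C haq)
    have h2 := worldAvg_roundValue_le hψ (hsub hbq) hba
    linarith

lemma worldAvg_drawValue_succ (G : List (Finset (Fin (2 * n)) × Finset (Fin (2 * n))))
    (k : ℕ) (cs : List (Bits ℓ)) (σ : State n m) (C : Finset (Fin (2 * n))) :
    worldAvg G (drawValue A (k + 1) cs σ) C = 𝔼 r : Bits ℓ,
      worldAvg G (roundValue A (drawValue A k (cs ++ [r])) (cs ++ [r]) σ) C :=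
  worldAvg_expect univ G _ C

lemma drawValue_nonneg (k : ℕ) (cs : List (Bits ℓ)) (σ : State n m) (C : Finset (Fin (2 * n))) :
    0 ≤ drawValue A k cs σ C :=
  (drawValue_mem_Icc A k cs σ C).1

lemma worldAvg_drawValue_le_one (G : List (Finset (Fin (2 * n)) × Finset (Fin (2 * n))))
    (k : ℕ) (cs : List (Bits ℓ)) (σ : State n m) (C : Finset (Fin (2 * n))) :
    worldAvg G (drawValue A k cs σ) C ≤ 1 :=
  (worldAvg_mono G fun D _ _ => (drawValue_mem_Icc A k cs σ D).2).trans_eq (worldAvg_const G 1 C)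

/-- With `j` pairs reserved, Alice survives with probability at most `2⁻ʲ`. -/
lemma worldAvg_drawValue_le_pow (k : ℕ) (cs : List (Bits ℓ)) (σ : State n m)
    (G : List (Finset (Fin (2 * n)) × Finset (Fin (2 * n)))) (C : Finset (Fin (2 * n)))
    (hG : Good G C) (hk : #(freeSet G C) + reserve G = 2 * k) :
    worldAvg G (drawValue A k cs σ) C ≤ (1 / 2) ^ G.length := by
  induction k generalizing cs σ G C with
  | zero =>
    have hnil : G = [] := by
      refine List.eq_nil_iff_forall_not_mem.2 fun p hp => ?_
      have h1 := Finset.card_pos.2 (hG.pair p hp).2.2.2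
      have h2 : #p.1 ≤ reserve G := List.single_le_sum (by simp) _ (List.mem_map_of_mem hp)
      omega
    subst hnil
    simp [worldAvg, drawValue]
  | succ k ih =>
    rw [worldAvg_drawValue_succ]
    refine Finset.expect_le Finset.univ_nonempty fun r _ => ?_
    by_cases haC : stateMove A σ (cs ++ [r]) ∈ C
    · exact (worldAvg_roundValue_of_mem G haC).trans (by positivity)
    by_cases haG : ∃ p ∈ G, stateMove A σ (cs ++ [r]) ∈ p.1 ∪ p.2
    · obtain ⟨p, hp, ha⟩ := haG
      obtain ⟨G', C', σ', hG', hlen, hsum, -, hle⟩ :=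
        exists_resolve (drawValue_nonneg (A := A) k (cs ++ [r])) hG hp ha
      have := ih (cs ++ [r]) σ' G' C' hG' (by omega)
      rw [← hlen, pow_succ]
      linarith
    · push Not at haG
      have ha := mem_freeSet.2 ⟨haC, haG⟩
      -- By parity the free set has a second element for Bob.
      obtain ⟨x, hx⟩ := hG.even_reserve
      have hpos := Finset.card_pos.2 ⟨_, ha⟩
      obtain ⟨b, hb, hba⟩ := Finset.exists_mem_ne (show 1 < #(freeSet G C) by omega)
        (stateMove A σ (cs ++ [r]))
      have hpair : {stateMove A σ (cs ++ [r]), b} ⊆ freeSet G C := by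
        rw [Finset.insert_subset_iff, Finset.singleton_subset_iff]
        exact ⟨ha, hb⟩
      have hcard := card_freeSet_union G hpair
      rw [Finset.card_pair hba.symm] at hcard
      exact (worldAvg_roundValue_le (drawValue_nonneg k (cs ++ [r])) hb hba).trans
        (ih _ _ G _ (hG.union hpair) (by omega))

end DrawValue

/-! ### Epochs of random play that create pairs -/

section Epoch

variable {n m ℓ : ℕ}

/-- The average of `ψ` over the next `t` random strings. -/
noncomputable def coinAvg : ℕ → (List (Bits ℓ) → ℝ) → List (Bits ℓ) → ℝ
  | 0, ψ, cs => ψ cs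
  | t + 1, ψ, cs => 𝔼 r : Bits ℓ, coinAvg t ψ (cs ++ [r])

lemma coinAvg_mono {ψ φ : List (Bits ℓ) → ℝ} (h : ∀ cs, ψ cs ≤ φ cs) (t : ℕ)
    (cs : List (Bits ℓ)) : coinAvg t ψ cs ≤ coinAvg t φ cs := by
  induction t generalizing cs with
  | zero => exact h cs
  | succ t ih => exact Finset.expect_le_expect fun r _ => ih _

lemma coinAvg_const (x : ℝ) (t : ℕ) (cs : List (Bits ℓ)) : coinAvg t (fun _ => x) cs = x := by
  induction t generalizing cs with
  | zero => rfl
  | succ t ih => simp only [coinAvg, ih, Finset.expect_const Finset.univ_nonempty]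

lemma coinAvg_sum {ι : Type*} (s : Finset ι) (ψ : ι → List (Bits ℓ) → ℝ) (t : ℕ)
    (cs : List (Bits ℓ)) :
    coinAvg t (fun cs' => ∑ i ∈ s, ψ i cs') cs = ∑ i ∈ s, coinAvg t (ψ i) cs := by
  induction t generalizing cs with
  | zero => rfl
  | succ t ih => simp only [coinAvg, ih, Finset.expect_sum_comm]

lemma coinAvg_mul (x : ℝ) (ψ : List (Bits ℓ) → ℝ) (t : ℕ) (cs : List (Bits ℓ)) :
    coinAvg t (fun cs' => x * ψ cs') cs = x * coinAvg t ψ cs := by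
  induction t generalizing cs with
  | zero => rfl
  | succ t ih => simp only [coinAvg, ih, Finset.mul_expect]

/-- Double counting: a set of size `s` that contains `C` and `a` has only `2 * t + 1` further
elements that `b` could be. -/
lemma sum_card_superset_le {ι α : Type*} [DecidableEq α] (B : Finset (ι × Finset α)) {s t : ℕ}
    (hB : ∀ q ∈ B, #q.2 = s) {C F : Finset α} {a : α} (hC : #C + 2 * (t + 1) = s) (ha : a ∉ C)
    (hF : ∀ b ∈ F, b ∉ C ∧ b ≠ a) :
    ∑ b ∈ F, #{q ∈ B | C ∪ {a, b} ⊆ q.2} ≤ (2 * t + 1) * #{q ∈ B | C ⊆ q.2} := by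
  have h := Finset.sum_card_bipartiteAbove_eq_sum_card_bipartiteBelow (s := F) (t := B)
    (fun b q => C ∪ {a, b} ⊆ q.2)
  simp only [Finset.bipartiteAbove, Finset.bipartiteBelow] at h
  rw [h, Finset.card_filter, Finset.mul_sum]
  refine Finset.sum_le_sum fun q hq => ?_
  rcases Finset.eq_empty_or_nonempty {b ∈ F | C ∪ {a, b} ⊆ q.2} with h0 | ⟨b, hb⟩
  · rw [h0, Finset.card_empty]
    exact Nat.zero_le _
  · have hsub := (Finset.mem_filter.1 hb).2
    have hCq : C ⊆ q.2 := Finset.subset_union_left.trans hsub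
    have haq : insert a C ⊆ q.2 := Finset.insert_subset (hsub (by simp)) hCq
    rw [if_pos hCq]
    have hle : #{b ∈ F | C ∪ {a, b} ⊆ q.2} ≤ #(q.2 \ insert a C) := by
      refine Finset.card_le_card fun x hx => ?_
      obtain ⟨hxF, hx⟩ := Finset.mem_filter.1 hx
      rw [Finset.mem_sdiff, Finset.mem_insert, not_or]
      exact ⟨hx (by simp), (hF x hxF).2, (hF x hxF).1⟩
    have h1 := Finset.card_sdiff_add_card_eq_card haq
    rw [Finset.card_insert_of_notMem ha, hB q hq] at h1
    omega

variable {A : AliceStrategy n m ℓ}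

/-- Bob plays random free numbers for `t` rounds.  If Alice does not play in a pair, it is unlikely
that a given set of numbers is used in these rounds. -/
lemma worldAvg_drawValue_le_coinAvg {G : List (Finset (Fin (2 * n)) × Finset (Fin (2 * n)))}
    {C₀ : Finset (Fin (2 * n))} {β : ℝ} (hβ : 0 ≤ β) {k₀ s f : ℕ}
    (bad : List (Bits ℓ) → Finset (State n m × Finset (Fin (2 * n))))
    (hbad : ∀ cs, ∀ q ∈ bad cs, #q.2 = s)
    (hres : ∀ k cs σ G' C', Good G' C' → G'.length + 1 = G.length →
      #(freeSet G' C') + reserve G' = 2 * k → f ≤ #(freeSet G' C') →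
      worldAvg G' (drawValue A k cs σ) C' ≤ 2 * β)
    (hend : ∀ cs σ C, Good G C → C₀ ⊆ C → #C = s → (σ, C) ∉ bad cs →
      worldAvg G (drawValue A k₀ cs σ) C ≤ β)
    (t : ℕ) (cs : List (Bits ℓ)) (σ : State n m) (C : Finset (Fin (2 * n)))
    (hG : Good G C) (hC₀ : C₀ ⊆ C) (hs : #C + 2 * t = s) (ht : 4 * t ≤ #(freeSet G C))
    (hf : f + 2 * t ≤ #(freeSet G C)) (hk : #(freeSet G C) + reserve G = 2 * (k₀ + t)) :
    worldAvg G (drawValue A (k₀ + t) cs σ) C ≤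
      β + (1 / 2) ^ t * coinAvg t (fun cs' => (#{q ∈ bad cs' | C ⊆ q.2} : ℝ)) cs := by
  induction t generalizing cs σ C with
  | zero =>
    rw [pow_zero, one_mul, coinAvg]
    -- In a bad end position the count is at least `1`, which covers the trivial bound on the value.
    by_cases hb : (σ, C) ∈ bad cs
    · have h1 : 1 ≤ #{q ∈ bad cs | C ⊆ q.2} :=
        Finset.card_pos.2 ⟨_, Finset.mem_filter.2 ⟨hb, subset_rfl⟩⟩
      have h2 : (1 : ℝ) ≤ #{q ∈ bad cs | C ⊆ q.2} := by exact_mod_cast h1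
      have h3 := worldAvg_drawValue_le_one (A := A) G (k₀ + 0) cs σ C
      linarith
    · exact (hend cs σ C hG hC₀ (by omega) hb).trans (le_add_of_nonneg_right (Nat.cast_nonneg _))
  | succ t ih =>
    set cnt : Finset (Fin (2 * n)) → List (Bits ℓ) → ℝ :=
      fun C cs' => (#{q ∈ bad cs' | C ⊆ q.2} : ℝ) with hcnt
    have hcnt0 : ∀ C t cs, 0 ≤ coinAvg t (cnt C) cs := fun C t cs =>
      (coinAvg_const 0 t cs).symm.trans_le (coinAvg_mono (fun _ => Nat.cast_nonneg _) t cs)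
    rw [← add_assoc, worldAvg_drawValue_succ, coinAvg, Finset.mul_expect,
      ← Finset.expect_const (Finset.univ_nonempty (α := Bits ℓ)) β, ← Finset.expect_add_distrib]
    refine Finset.expect_le_expect fun r _ => ?_
    have hpos : 0 ≤ (1 / 2 : ℝ) ^ (t + 1) * coinAvg t (cnt C) (cs ++ [r]) :=
      mul_nonneg (by positivity) (hcnt0 _ _ _)
    by_cases haC : stateMove A σ (cs ++ [r]) ∈ C
    · exact (worldAvg_roundValue_of_mem G haC).trans (add_nonneg hβ hpos)
    by_cases haG : ∃ p ∈ G, stateMove A σ (cs ++ [r]) ∈ p.1 ∪ p.2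
    · obtain ⟨p, hp, ha⟩ := haG
      obtain ⟨G', C', σ', hG', hlen, hsum, hfree, hle⟩ :=
        exists_resolve (drawValue_nonneg (A := A) (k₀ + t) (cs ++ [r])) hG hp ha
      -- The bound `2 * β` with one pair fewer suffices, since half of the worlds are lost.
      have := hres (k₀ + t) (cs ++ [r]) σ' G' C' hG' hlen (by omega) (by omega)
      linarith
    · push Not at haG
      have ha := mem_freeSet.2 ⟨haC, haG⟩
      set a := stateMove A σ (cs ++ [r]) with hadef
      set F := (freeSet G C).erase a with hF
      have hFcard : #F + 1 = #(freeSet G C) := Finset.card_erase_add_one ha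
      -- The bound holds for every free answer `b`, hence for their average; this is the random
      -- play.
      have hstep : ∀ b ∈ F, worldAvg G (roundValue A (drawValue A (k₀ + t) (cs ++ [r]))
          (cs ++ [r]) σ) C ≤ β + (1 / 2) ^ t * coinAvg t (cnt (C ∪ {a, b})) (cs ++ [r]) := by
        intro b hb
        obtain ⟨hba, hb⟩ := Finset.mem_erase.1 hb
        have hpair : {a, b} ⊆ freeSet G C := by
          rw [Finset.insert_subset_iff, Finset.singleton_subset_iff]
          exact ⟨ha, hb⟩
        have hcard := card_freeSet_union G hpair
        have hdisj : Disjoint C {a, b} :=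
          Finset.disjoint_right.2 fun x hx => (mem_freeSet.1 (hpair hx)).1
        have hcardC := Finset.card_union_of_disjoint hdisj
        rw [Finset.card_pair hba.symm] at hcard hcardC
        exact (worldAvg_roundValue_le (drawValue_nonneg _ _) hb hba).trans
          (ih (cs ++ [r]) _ (C ∪ {a, b}) (hG.union hpair)
            (hC₀.trans Finset.subset_union_left) (by omega) (by omega) (by omega) (by omega))
      have hsum := Finset.sum_le_sum hstep
      rw [Finset.sum_const, Finset.sum_add_distrib, Finset.sum_const, ← Finset.mul_sum,
        ← coinAvg_sum, nsmul_eq_mul, nsmul_eq_mul] at hsum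
      have hcount : coinAvg t (fun cs' => ∑ b ∈ F, cnt (C ∪ {a, b}) cs') (cs ++ [r]) ≤
          (2 * t + 1) * coinAvg t (cnt C) (cs ++ [r]) := by
        rw [← coinAvg_mul]
        refine coinAvg_mono (fun cs' => ?_) _ _
        have := sum_card_superset_le (bad cs') (hbad cs') hs haC (F := F) fun b hb =>
          ⟨(mem_freeSet.1 (Finset.mem_erase.1 hb).2).1, (Finset.mem_erase.1 hb).1⟩
        simp only [hcnt]
        exact_mod_cast this
      have hFpos : (0 : ℝ) < #F := by
        have : 0 < #F := by omega
        exact_mod_cast this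
      -- At least `4 * (t + 1) - 1` answers are available and at most `2 * t + 1` of them stay
      -- inside a given bad set: each round gains a factor `1/2`.
      have hFbig : 2 * (2 * (t : ℝ) + 1) ≤ #F := by
        have : 2 * (2 * t + 1) ≤ #F := by omega
        exact_mod_cast this
      have h0 := hcnt0 C t (cs ++ [r])
      refine le_of_mul_le_mul_left (hsum.trans ?_) hFpos
      rw [mul_add, pow_succ]
      have h1 : (1 / 2 : ℝ) ^ t * coinAvg t (fun cs' => ∑ b ∈ F, cnt (C ∪ {a, b}) cs') (cs ++ [r])
          ≤ (1 / 2) ^ t * ((#F / 2) * coinAvg t (cnt C) (cs ++ [r])) := by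
        refine mul_le_mul_of_nonneg_left (hcount.trans ?_) (by positivity)
        exact mul_le_mul_of_nonneg_right (by linarith) h0
      linarith

/-- The main estimate: with `G.length` pairs reserved, and `q` more to be made in epochs of `T`
rounds, Alice survives with probability at most about `2 ^ (-(G.length + q))`. -/
theorem worldAvg_drawValue_le (T q : ℕ) (k : ℕ) (cs : List (Bits ℓ))
    (σ : State n m) (G : List (Finset (Fin (2 * n)) × Finset (Fin (2 * n))))
    (C : Finset (Fin (2 * n))) (hG : Good G C) (hk : #(freeSet G C) + reserve G = 2 * k)
    (hf : 2 * T * G.length + 6 * T * q ≤ #(freeSet G C)) :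
    worldAvg G (drawValue A k cs σ) C ≤ (1 / 2) ^ (G.length + q) +
      2 * q * ((1 / 2) ^ T * (Fintype.card (State n m) * (2 * n + 1))) := by
  classical
  set δ : ℝ := (1 / 2) ^ T * (Fintype.card (State n m) * (2 * n + 1)) with hδ
  have hδ0 : 0 ≤ δ := by positivity
  induction q generalizing k cs σ G C with
  | zero =>
    simpa using worldAvg_drawValue_le_pow k cs σ G C hG hk
  | succ q ihq =>
    induction hj : G.length using Nat.strong_induction_on generalizing k cs σ G C with
    | _ j ihj =>
    subst hj
    -- The target before the last `δ`, which pays for reaching a bad set. The coefficient `2 * q +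
    -- 1` is at least the `2 * q` of the case with one more pair, and its double is at least the `2
    -- * (q + 1)` of the case with one pair fewer.
    set β : ℝ := (1 / 2) ^ (G.length + (q + 1)) + (2 * q + 1) * δ with hβ
    have hβ0 : 0 ≤ β := by positivity
    let bad : List (Bits ℓ) → Finset (State n m × Finset (Fin (2 * n))) := fun cs' =>
      univ.filter fun p => Good G p.2 ∧ C ⊆ p.2 ∧ #p.2 = #C + 2 * T ∧
        β < worldAvg G (drawValue A (k - T) cs' p.1) p.2
    have hfree : ∀ D, Good G D → C ⊆ D → #D = #C + 2 * T →
        #(freeSet G D) + 2 * T = #(freeSet G C) := by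
      intro D hD hCD hcard
      have hsub : D \ C ⊆ freeSet G C := fun x hx => by
        obtain ⟨hxD, hxC⟩ := Finset.mem_sdiff.1 hx
        exact mem_freeSet.2 ⟨hxC, fun p hp => Finset.disjoint_left.1 (hD.base p hp) hxD⟩
      have h1 := card_freeSet_union G hsub
      have h2 := Finset.card_sdiff_add_card_eq_card hCD
      rw [Finset.union_sdiff_of_subset hCD] at h1
      omega
    have hT : 2 * T * G.length + 6 * T * (q + 1) = 2 * T * G.length + 6 * T * q + 6 * T := by ring
    have hcount : ∀ cs', (#(bad cs') : ℝ) ≤ Fintype.card (State n m) * (2 * n + 1) := by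
      intro cs'
      have hfib : ∀ σ' ∈ (univ : Finset (State n m)),
          #{p ∈ bad cs' | p.1 = σ'} ≤ 2 * n + 1 := by
        intro σ' _
        have hinj : Set.InjOn Prod.snd
            (({p ∈ bad cs' | p.1 = σ'} : Finset _) : Set (State n m × Finset (Fin (2 * n)))) := by
          intro x hx y hy hxy
          rw [Finset.mem_coe, Finset.mem_filter] at hx hy
          exact Prod.ext (hx.2.trans hy.2.symm) hxy
        rw [← Finset.card_image_of_injOn hinj]
        have hmem : ∀ D ∈ image Prod.snd {p ∈ bad cs' | p.1 = σ'}, Good G D ∧ C ⊆ D ∧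
            #D = #C + 2 * T ∧ β < worldAvg G (drawValue A (k - T) cs' σ') D := by
          intro D hD
          obtain ⟨p, hp, rfl⟩ := Finset.mem_image.1 hD
          obtain ⟨hpb, hpσ⟩ := Finset.mem_filter.1 hp
          exact hpσ ▸ (Finset.mem_filter.1 hpb).2
        refine (card_le_of_odd_sdiff _ (#C + 2 * T) (fun D hD => (hmem D hD).2.2.1) ?_).trans_eq
          (by rw [Fintype.card_fin])
        intro D hD E hE hne
        obtain ⟨hD, hCD, hDcard, hDβ⟩ := hmem D hD
        obtain ⟨hE, hCE, hEcard, hEβ⟩ := hmem E hE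
        by_contra hodd
        have heven := Nat.not_odd_iff_even.1 hodd
        have hpair := hD.cons_of_even_sdiff hE (hDcard.trans hEcard.symm) hne heven
        have hfc := card_freeSet_cons_sdiff (C := D) hE
        have hfD := hfree D hD hCD hDcard
        have hEC : #(E \ D) ≤ 2 * T := by
          have h1 := Finset.card_sdiff_add_card_eq_card hCE
          have h2 := Finset.card_le_card (Finset.sdiff_subset_sdiff (subset_refl E) hCD)
          omega
        have hDE : #(D \ E) = #(E \ D) := (hpair.pair _ List.mem_cons_self).2.1
        have hres : reserve ((D \ E, E \ D) :: G) = #(D \ E) + reserve G := rfl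
        have hlen : 2 * T * ((D \ E, E \ D) :: G).length = 2 * T * G.length + 2 * T := by
          rw [List.length_cons]; ring
        -- The epoch uses `2 * T` free numbers and the new pair takes at most `2 * T` more; the last
        -- `2 * T` of the budget `6 * T` are the allowance for the longer list.
        have h := ihq (k - T) cs' σ' _ _ hpair (by omega) (by omega)
        have hDu : D ∩ E ∪ D \ E = D := by rw [Finset.union_comm, Finset.sdiff_union_inter]
        have hEu : D ∩ E ∪ E \ D = E := by
          rw [Finset.inter_comm, Finset.union_comm, Finset.sdiff_union_inter]
        rw [worldAvg, hDu, hEu, List.length_cons, add_right_comm, add_assoc] at h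
        linarith
      have h := Finset.card_le_mul_card_image_of_maps_to
        (f := Prod.fst) (s := bad cs') (t := univ) (fun _ _ => Finset.mem_univ _) (2 * n + 1) hfib
      rw [Finset.card_univ, mul_comm (2 * n + 1)] at h
      exact_mod_cast h
    have hkT : k = k - T + T := by omega
    -- When Alice enters a pair during the epoch, the epoch is abandoned: at most `2 * T` free
    -- numbers are lost, which the allowance `2 * T` of the vanished pair covers.
    have hmain := worldAvg_drawValue_le_coinAvg (A := A) (G := G) (C₀ := C) hβ0 (k₀ := k - T)
      (s := #C + 2 * T) (f := 2 * T * G.length + 6 * T * (q + 1) - 2 * T) bad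
      (fun cs' p hp => (Finset.mem_filter.1 hp).2.2.2.1) ?_ ?_ T cs σ C hG subset_rfl rfl
      (by omega) (by omega) (by omega)
    · rw [← hkT] at hmain
      have h1 : coinAvg T (fun cs' => (#{p ∈ bad cs' | C ⊆ p.2} : ℝ)) cs ≤
          Fintype.card (State n m) * (2 * n + 1) := by
        refine (coinAvg_mono (fun cs' => ?_) T cs).trans_eq (coinAvg_const _ T cs)
        exact (Nat.cast_le.2 (Finset.card_filter_le _ _)).trans (hcount cs')
      have h2 := mul_le_mul_of_nonneg_left h1 (show (0 : ℝ) ≤ (1 / 2) ^ T by positivity)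
      rw [← hδ] at h2
      push_cast
      linarith
    · intro k' cs' σ' G' C' hG' hlen hk' hf'
      have h := ihj G'.length (by omega) k' cs' σ' G' C' hG' hk'
        (by
          have : 2 * T * (G'.length + 1) = 2 * T * G'.length + 2 * T := by ring
          rw [← hlen] at hf'
          omega) rfl
      rw [hβ, ← hlen, add_right_comm, pow_succ]
      push_cast at h
      nlinarith [mul_nonneg (Nat.cast_nonneg (α := ℝ) q) hδ0]
    · intro cs' σ' D hD hCD hDcard hnot
      by_contra hlt
      exact hnot (Finset.mem_filter.2 ⟨Finset.mem_univ _, hD, hCD, hDcard, not_le.1 hlt⟩)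

end Epoch

/-! ### From the value to a strategy of Bob -/

section Optimal

variable {n m ℓ : ℕ}

/-- The state of Alice after the history `h`. -/
def stateOf (h : List (Round n m ℓ)) : State n m :=
  h.getLast?.map fun q => (q.bob, q.mem)

/-- Bob's optimal strategy: he moves to a position of least value. -/
noncomputable def optimalBob (A : AliceStrategy n m ℓ) : BobStrategy n m ℓ := fun h r x a =>
  haveI : Nonempty (Fin (2 * n)) := ⟨a⟩
  -- `n - 1 - h.length` rounds follow the current one; the subtraction truncates only after the game
  -- is over.
  PMF.pure (Finite.exists_min (bobValue (drawValue A (n - 1 - h.length) (coinsSoFar h r)) x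
    (insert a (moves h).toFinset))).choose

/-- The value of a history with `k` rounds left. -/
noncomputable def historyValue (A : AliceStrategy n m ℓ) (k : ℕ) (h : List (Round n m ℓ)) : ℝ≥0∞ :=
  open Classical in
  if AliceLoses (moves h) then 0
  else if (moves h).Nodup then
    ENNReal.ofReal (drawValue A k (h.map Round.coins) (stateOf h) (moves h).toFinset)
  -- Here the first repetition was Bob's.
  else 1

variable (A : AliceStrategy n m ℓ)

lemma stateMem_stateOf (h : List (Round n m ℓ)) (r : Bits ℓ) :
    stateMem A (stateOf h) (coinsSoFar h r) = memory A h r := by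
  unfold stateMem stateOf memory
  cases h.getLast? <;> rfl

lemma stateMove_stateOf (h : List (Round n m ℓ)) (r : Bits ℓ) :
    stateMove A (stateOf h) (coinsSoFar h r) = aliceMove A h r := by
  rw [stateMove, stateMem_stateOf, aliceMove]

lemma historyValue_le_one (k : ℕ) (h : List (Round n m ℓ)) : historyValue A k h ≤ 1 := by
  unfold historyValue
  split_ifs
  · exact zero_le_one
  · exact ENNReal.ofReal_le_one.2 (drawValue_mem_Icc A k _ _ _).2
  · exact le_rfl

lemma moves_append (h : List (Round n m ℓ)) (q : Round n m ℓ) :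
    moves (h ++ [q]) = moves h ++ [q.alice, q.bob] := by
  simp [moves]

lemma length_moves (h : List (Round n m ℓ)) : (moves h).length = 2 * h.length := by
  induction h with
  | nil => rfl
  | cons q h ih =>
    have : moves (q :: h) = [q.alice, q.bob] ++ moves h := rfl
    rw [this, List.length_append, ih, List.length_cons]
    simp only [List.length_cons, List.length_nil]
    ring

lemma AliceLoses.append {w : List (Fin (2 * n))} (hw : AliceLoses w) (v : List (Fin (2 * n))) :
    AliceLoses (w ++ v) := by
  obtain ⟨i, h1, h2⟩ := hw
  have hlen : 2 * i + 1 ≤ w.length := by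
    by_contra hlt
    rw [List.take_of_length_le (by omega)] at h1 h2
    exact h2 h1
  refine ⟨i, ?_, ?_⟩
  · rwa [List.take_append_of_le_length (by omega)]
  · rwa [List.take_append_of_le_length hlen]

lemma aliceLoses_of_mem {h : List (Round n m ℓ)} {q : Round n m ℓ} (hnd : (moves h).Nodup)
    (hq : q.alice ∈ moves h) : AliceLoses (moves (h ++ [q])) := by
  refine ⟨h.length, ?_, ?_⟩
  · rwa [moves_append, ← length_moves, List.take_left]
  · have : moves (h ++ [q]) = (moves h ++ [q.alice]) ++ [q.bob] := by
      rw [moves_append, List.append_assoc]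
      rfl
    rw [this, List.take_left' (by simp [length_moves])]
    intro hnd'
    exact (List.nodup_append.1 hnd').2.2 _ hq _ (List.mem_singleton_self _) rfl

/-- The expectation of a nonnegative function. -/
noncomputable def expectation {α : Type*} (p : PMF α) (f : α → ℝ≥0∞) : ℝ≥0∞ := ∑' x, p x * f x

lemma expectation_pure {α : Type*} (x : α) (f : α → ℝ≥0∞) : expectation (PMF.pure x) f = f x := by
  classical
  unfold expectation
  rw [tsum_eq_single x]
  · simp
  · intro y hy
    simp [PMF.pure_apply, hy]

lemma expectation_bind {α β : Type*} (p : PMF α) (q : α → PMF β) (f : β → ℝ≥0∞) :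
    expectation (p.bind q) f = ∑' x, p x * expectation (q x) f := by
  unfold expectation
  simp only [PMF.bind_apply, ← ENNReal.tsum_mul_right, ← ENNReal.tsum_mul_left]
  rw [ENNReal.tsum_comm]
  simp only [mul_assoc]

lemma expectation_le_one {α : Type*} (p : PMF α) {f : α → ℝ≥0∞} (hf : ∀ x, f x ≤ 1) :
    expectation p f ≤ 1 :=
  (ENNReal.tsum_le_tsum fun x => mul_le_of_le_one_right' (hf x)).trans_eq p.tsum_coe

lemma ofReal_expect {ι : Type*} [Fintype ι] [Nonempty ι] (v : ι → ℝ) (hv : ∀ i, 0 ≤ v i) :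
    ENNReal.ofReal (𝔼 i, v i) =
      ∑ i, ((Fintype.card ι : ℝ≥0∞))⁻¹ * ENNReal.ofReal (v i) := by
  have hpos : (0 : ℝ) < Fintype.card ι := by exact_mod_cast Fintype.card_pos
  rw [Fintype.expect_eq_sum_div_card, ENNReal.ofReal_div_of_pos hpos, ENNReal.ofReal_natCast,
    ENNReal.ofReal_sum_of_nonneg fun i _ => hv i, ENNReal.div_eq_inv_mul, Finset.mul_sum]

/-- The value is a supermartingale under `optimalBob`, because his answer attains the infimum in
`roundValue` and Alice's fresh coins give the average in `drawValue`. -/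
lemma expectation_playRound_le (k : ℕ) (h : List (Round n m ℓ)) (hk : h.length + (k + 1) = n) :
    expectation (playRound A (optimalBob A) h) (historyValue A k) ≤ historyValue A (k + 1) h := by
  have hexp : expectation (playRound A (optimalBob A) h) (historyValue A k) =
      ∑' r, PMF.uniformOfFintype (Bits ℓ) r * expectation
        ((optimalBob A h r (memory A h r) (aliceMove A h r)).map fun b =>
          h ++ [⟨r, memory A h r, aliceMove A h r, b⟩]) (historyValue A k) :=
    expectation_bind _ _ _
  by_cases hl : AliceLoses (moves h)
  · rw [hexp]
    refine (ENNReal.tsum_eq_zero.2 fun r => ?_).trans_le zero_le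
    rw [optimalBob, PMF.pure_map, expectation_pure, historyValue, if_pos, mul_zero]
    rw [moves_append]
    exact hl.append _
  by_cases hnd : (moves h).Nodup
  swap
  · rw [historyValue, if_neg hl, if_neg hnd]
    exact expectation_le_one _ (historyValue_le_one A k)
  have hψ := fun r : Bits ℓ => drawValue_mem_Icc A k (h.map Round.coins ++ [r])
  rw [historyValue, if_neg hl, if_pos hnd, hexp, tsum_fintype, drawValue,
    ofReal_expect _ fun r => (roundValue_mem_Icc A (hψ r) _ _ _).1]
  refine Finset.sum_le_sum fun r _ => ?_
  rw [PMF.uniformOfFintype_apply]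
  refine mul_le_mul_right ?_ _
  change _ ≤ ENNReal.ofReal (roundValue A (drawValue A k (coinsSoFar h r)) (coinsSoFar h r) _ _)
  have : Nonempty (Fin (2 * n)) := ⟨aliceMove A h r⟩
  set f := bobValue (drawValue A (n - 1 - h.length) (coinsSoFar h r)) (memory A h r)
    (insert (aliceMove A h r) (moves h).toFinset) with hf
  rw [optimalBob, PMF.pure_map, expectation_pure]
  have hmin := (Finite.exists_min f).choose_spec
  set b := (Finite.exists_min f).choose
  change historyValue A k (h ++ [⟨r, memory A h r, aliceMove A h r, b⟩]) ≤ _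
  by_cases ha : aliceMove A h r ∈ moves h
  · rw [historyValue, if_pos (aliceLoses_of_mem hnd ha)]
    exact zero_le
  have hround : f b ≤ roundValue A (drawValue A k (coinsSoFar h r)) (coinsSoFar h r) (stateOf h)
      (moves h).toFinset := by
    rw [roundValue, stateMove_stateOf, stateMem_stateOf, if_neg (by rwa [List.mem_toFinset])]
    rw [hf, show n - 1 - h.length = k by omega] at hmin
    rw [hf, show n - 1 - h.length = k by omega]
    exact le_ciInf hmin
  refine le_trans ?_ (ENNReal.ofReal_le_ofReal hround)
  by_cases hb : b ∈ insert (aliceMove A h r) (moves h).toFinset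
  · rw [hf, bobValue, if_pos hb, ENNReal.ofReal_one]
    exact historyValue_le_one A k _
  · rw [hf, bobValue, if_neg hb, historyValue]
    split_ifs with h1 h2
    · exact zero_le
    · refine ENNReal.ofReal_le_ofReal (le_of_eq ?_)
      have h3 : (moves (h ++ [⟨r, memory A h r, aliceMove A h r, b⟩])).toFinset =
          insert b (insert (aliceMove A h r) (moves h).toFinset) := by
        ext x
        simp only [moves_append, List.mem_toFinset, List.mem_append, Finset.mem_insert,
          List.mem_cons, List.not_mem_nil]
        tauto
      rw [h3, show n - 1 - h.length = k by omega]
      simp [stateOf, coinsSoFar]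
    · refine absurd ?_ h2
      simp only [Finset.mem_insert, List.mem_toFinset, not_or] at hb
      rw [moves_append, List.nodup_append]
      refine ⟨hnd, ?_, ?_⟩
      · simpa using Ne.symm hb.1
      · intro x hx y hy
        simp only [List.mem_cons, List.not_mem_nil, or_false] at hy
        rcases hy with rfl | rfl
        · exact fun hxy => ha (hxy ▸ hx)
        · exact fun hxy => hb.2 (hxy ▸ hx)

lemma length_of_mem_support_play (B : BobStrategy n m ℓ) (k : ℕ) {h : List (Round n m ℓ)}
    (hh : h ∈ (play A B k).support) : h.length = k := by
  induction k generalizing h with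
  | zero =>
    rw [play, PMF.mem_support_pure_iff] at hh
    rw [hh, List.length_nil]
  | succ k ih =>
    rw [play, PMF.mem_support_bind_iff] at hh
    obtain ⟨h', hh', hh⟩ := hh
    rw [playRound, PMF.mem_support_bind_iff] at hh
    obtain ⟨r, -, hh⟩ := hh
    rw [PMF.mem_support_map_iff] at hh
    obtain ⟨b, -, rfl⟩ := hh
    rw [List.length_append, ih hh', List.length_singleton]

lemma expectation_play_le {j k : ℕ} (hjk : j + k = n) :
    expectation (play A (optimalBob A) j) (historyValue A k) ≤
      ENNReal.ofReal (drawValue A n [] none ∅) := by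
  induction j generalizing k with
  | zero =>
    obtain rfl : k = n := by omega
    rw [play, expectation_pure, historyValue]
    split_ifs with h1 h2
    · exact zero_le
    · exact le_rfl
    · exact absurd List.nodup_nil h2
  | succ j ih =>
    refine le_trans ?_ (ih (k := k + 1) (by omega))
    rw [play, expectation_bind]
    refine ENNReal.tsum_le_tsum fun h => ?_
    by_cases hh : h ∈ (play A (optimalBob A) j).support
    · have hlen := length_of_mem_support_play A _ j hh
      exact mul_le_mul_right (expectation_playRound_le A k h (by omega)) _
    · rw [(PMF.apply_eq_zero_iff _ _).2 hh, zero_mul, zero_mul]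

lemma one_sub_drawValue_le_lossProb :
    1 - drawValue A n [] none ∅ ≤ lossProb A (optimalBob A) := by
  set S : Set (List (Round n m ℓ)) := {h | AliceLoses (moves h)}
  set p := play A (optimalBob A) n
  -- With no rounds left, `historyValue` is the indicator that Alice has not lost.
  have hsum : p.toOuterMeasure S + expectation p (historyValue A 0) = 1 := by
    rw [PMF.toOuterMeasure_apply, expectation, ← ENNReal.tsum_add, ← p.tsum_coe]
    refine tsum_congr fun h => ?_
    by_cases hl : AliceLoses (moves h)
    · rw [Set.indicator_of_mem (show h ∈ S from hl), historyValue, if_pos hl, mul_zero, add_zero]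
    · rw [Set.indicator_of_notMem (show h ∉ S from hl), historyValue, if_neg hl]
      simp [drawValue]
  have hle := expectation_play_le A (j := n) (k := 0) rfl
  have htop : p.toOuterMeasure S ≠ ⊤ := ne_top_of_le_ne_top ENNReal.one_ne_top (hsum ▸ le_self_add)
  have h1 : (1 : ℝ≥0∞) ≤ p.toOuterMeasure S + ENNReal.ofReal (drawValue A n [] none ∅) :=
    hsum.symm.trans_le (by gcongr)
  have h2 := ENNReal.toReal_mono (ENNReal.add_ne_top.2 ⟨htop, ENNReal.ofReal_ne_top⟩) h1
  rw [ENNReal.toReal_add htop ENNReal.ofReal_ne_top, ENNReal.toReal_one,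
    ENNReal.toReal_ofReal (drawValue_nonneg _ _ _ _)] at h2
  rw [lossProb]
  linarith

lemma drawValue_start_le {T q : ℕ} (hT : 6 * T * q ≤ 2 * n) :
    drawValue A n [] none ∅ ≤ (1 / 2) ^ q +
      2 * q * ((1 / 2) ^ T * ((2 * n * 2 ^ m + 1) * (2 * n + 1))) := by
  have hfree : freeSet [] (∅ : Finset (Fin (2 * n))) = univ := by
    ext x
    simp [mem_freeSet]
  have hcard : Fintype.card (State n m) = 2 * n * 2 ^ m + 1 := by
    simp [Fintype.card_option]
  have h := worldAvg_drawValue_le (A := A) T q n [] none [] ∅ ⟨by simp, by simp, by simp⟩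
    (by simp [hfree, reserve]) (by simpa [hfree] using hT)
  rw [hcard] at h
  push_cast at h
  simpa [worldAvg] using h

end Optimal

/-! ### Choice of parameters and the error term -/

section Asymptotics

open Filter Topology

/-- The memory bound leaves a linear gap: `T + 1 ≥ n / (3c)` and `m ≤ n / (4c)`, and `1/3 - 1/4 =
1/12`. The factor `2` pays for the floor in `T`. -/
lemma two_pow_mul_half_pow_le {c : ℝ} (hc : 2 ≤ c) {n m : ℕ} (hm : (m : ℝ) ≤ n / (4 * c)) :
    (2 : ℝ) ^ m * (1 / 2) ^ (n / (3 * ⌈c / 2⌉₊)) ≤ 2 * ((2 : ℝ) ^ (-1 / (12 * c))) ^ n := by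
  have hc0 : 0 < c := by linarith
  set k := ⌈c / 2⌉₊ with hk
  set T := n / (3 * k) with hT
  -- This uses `c ≥ 2`: the ceiling is less than `c / 2 + 1 ≤ c`.
  have hkc : (k : ℝ) ≤ c := by
    have := Nat.ceil_lt_add_one (show 0 ≤ c / 2 by linarith)
    linarith
  have hk0 : 0 < k := Nat.ceil_pos.2 (by linarith)
  have hTn : (n : ℝ) / (3 * c) ≤ T + 1 := by
    have h1 : n < 3 * k * (T + 1) := Nat.lt_mul_div_succ n (by omega)
    have h2 : (n : ℝ) ≤ 3 * k * (T + 1) := by exact_mod_cast h1.le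
    rw [div_le_iff₀ (by positivity)]
    refine h2.trans ?_
    have : 0 ≤ (T : ℝ) + 1 := by positivity
    nlinarith
  have hexp : (m : ℝ) - T ≤ 1 + -1 / (12 * c) * n := by
    have h1 : -1 / (12 * c) * n = n / (4 * c) - n / (3 * c) := by
      field_simp
      ring
    linarith
  calc (2 : ℝ) ^ m * (1 / 2) ^ T = 2 ^ ((m : ℝ) - T) := by
        rw [Real.rpow_sub two_pos, Real.rpow_natCast, Real.rpow_natCast, one_div, inv_pow,
          div_eq_mul_inv]
    _ ≤ 2 ^ (1 + -1 / (12 * c) * n) := Real.rpow_le_rpow_of_exponent_le one_le_two hexp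
    _ = 2 * ((2 : ℝ) ^ (-1 / (12 * c))) ^ n := by
        rw [Real.rpow_add two_pos, Real.rpow_one, Real.rpow_mul zero_le_two, Real.rpow_natCast]

lemma exists_error_le {c δ : ℝ} (hc : 2 ≤ c) (hδ : 0 < δ) : ∃ N : ℕ, ∀ n m : ℕ, N ≤ n →
    (m : ℝ) ≤ n / (4 * c) → 2 * (⌈c / 2⌉₊ : ℝ) * ((1 / 2) ^ (n / (3 * ⌈c / 2⌉₊)) *
      ((2 * n * 2 ^ m + 1) * (2 * n + 1))) ≤ δ := by
  have hc0 : 0 < c := by linarith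
  set k := ⌈c / 2⌉₊ with hk
  set ρ : ℝ := 2 ^ (-1 / (12 * c)) with hρ
  have hρ0 : 0 < ρ := Real.rpow_pos_of_pos two_pos _
  have hρ1 : ρ < 1 :=
    Real.rpow_lt_one_of_one_lt_of_neg one_lt_two (div_neg_of_neg_of_pos (by norm_num) (by positivity))
  have hlim : Tendsto (fun n : ℕ => 36 * (k : ℝ) * ((n : ℝ) ^ 2 * ρ ^ n)) atTop (𝓝 0) := by
    have := (tendsto_pow_const_mul_const_pow_of_abs_lt_one 2
      (by rwa [abs_of_pos hρ0] : |ρ| < 1)).const_mul (36 * (k : ℝ))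
    rwa [mul_zero] at this
  obtain ⟨N, hN⟩ := eventually_atTop.1 (hlim.eventually (eventually_le_nhds hδ))
  refine ⟨max N 1, fun n m hn hm => ?_⟩
  refine le_trans ?_ (hN n (le_of_max_le_left hn))
  have hn1 : (1 : ℝ) ≤ n := by exact_mod_cast le_of_max_le_right hn
  have hpow := two_pow_mul_half_pow_le hc hm
  have hm1 : (1 : ℝ) ≤ 2 ^ m := one_le_pow₀ one_le_two
  have hprod : (2 * n * 2 ^ m + 1) * (2 * n + 1) ≤ 2 ^ m * (9 * (n : ℝ) ^ 2) := by
    have h1 : 2 * (n : ℝ) * 2 ^ m + 1 ≤ 2 ^ m * (3 * n) := by nlinarith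
    have h2 : 2 * (n : ℝ) + 1 ≤ 3 * n := by linarith
    calc (2 * n * 2 ^ m + 1) * (2 * n + 1) ≤ 2 ^ m * (3 * n) * (3 * (n : ℝ)) := by gcongr
      _ = 2 ^ m * (9 * (n : ℝ) ^ 2) := by ring
  calc 2 * (k : ℝ) * ((1 / 2) ^ (n / (3 * k)) * ((2 * n * 2 ^ m + 1) * (2 * n + 1)))
      ≤ 2 * (k : ℝ) * ((1 / 2) ^ (n / (3 * k)) * (2 ^ m * (9 * (n : ℝ) ^ 2))) := by gcongr
    _ = 18 * k * n ^ 2 * (2 ^ m * (1 / 2) ^ (n / (3 * k))) := by ring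
    _ ≤ 18 * k * n ^ 2 * (2 * ρ ^ n) := by gcongr
    _ = 36 * k * (n ^ 2 * ρ ^ n) := by ring

end Asymptotics

end MirrorGame

theorem mainTheorem3 (c : ℝ) (hc : 2 ≤ c) :
    ∃ B : (n m ℓ : ℕ) → MirrorGame.AliceStrategy n m ℓ → MirrorGame.BobStrategy n m ℓ,
      ∀ ε : ℝ, 0 < ε → ∃ N : ℕ, ∀ n : ℕ, N ≤ n →
        ∀ (m ℓ : ℕ) (A : MirrorGame.AliceStrategy n m ℓ), (m : ℝ) ≤ (n : ℝ) / (4 * c) →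
          1 - (1 / 2 + ε) ^ (c / 2) ≤ MirrorGame.lossProb A (B n m ℓ A) := by
  refine ⟨fun n m ℓ A => MirrorGame.optimalBob A, fun ε hε => ?_⟩
  have hgap : (1 / 2 : ℝ) ^ (c / 2) < (1 / 2 + ε) ^ (c / 2) :=
    Real.rpow_lt_rpow (by norm_num) (by linarith) (by linarith)
  -- The error only has to fit between the `c / 2` powers of `1 / 2` and `1 / 2 + ε`; Bob's strategy
  -- does not involve `ε`.
  obtain ⟨N, hN⟩ := MirrorGame.exists_error_le hc (sub_pos.2 hgap)
  refine ⟨N, fun n hn m ℓ A hm => ?_⟩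
  have hT : 6 * (n / (3 * ⌈c / 2⌉₊)) * ⌈c / 2⌉₊ ≤ 2 * n := by
    have := Nat.div_mul_le_self n (3 * ⌈c / 2⌉₊)
    nlinarith
  have h1 := MirrorGame.drawValue_start_le A hT
  have h2 := MirrorGame.one_sub_drawValue_le_lossProb A
  have h3 : (1 / 2 : ℝ) ^ ⌈c / 2⌉₊ ≤ (1 / 2) ^ (c / 2) := by
    rw [← Real.rpow_natCast]
    exact Real.rpow_le_rpow_of_exponent_ge (by norm_num) (by norm_num) (Nat.le_ceil _)
  have h4 := hN n m hn hm
  linarith
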